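/- Let $R$ be a commutative $\mathbb{Q}$-algebra (for example $R=\mathbb{C}$). "Functions of $t=(t_1=x,t_3,t_5,\dots)$" are formal power series in these infinitely many variables over $R$; write $\partial_{2k+1}=\partial/\partial t_{2k+1}$, $\partial=\partial/\partial x$, $f_x=\partial f/\partial x$. Pseudodifferential operators are formal sums $P=\sum_{i\le N}a_i(t)\partial^i$, composed by $\partial^i f=\sum_{k\ge0}\binom{i}{k}f^{(k)}\partial^{i-k}$, with $P_+=\sum_{i\ge0}a_i\partial^i$, $P_-=P-P_+$ and formal adjoint $P^*=\sum_i(-\partial)^ia_i$; for a differential operator $B$, $B(f)$ denotes its action on $f$. Let $L=\partial+u_1\partial^{-1}+u_2\partial^{-2}+\cdots$ be a solution of the BKP hierarchy, i.e. $L^*=-\partial L\partial^{-1}$ and $\partial_{2k+1}L=[B_{2k+1},L]$ with $B_{2k+1}=(L^{2k+1})_+$ for all $k\ge0$. Let $W=1+w_1\partial^{-1}+w_2\partial^{-2}+\cdots$ be a dressing operator of it, i.e. $L=W\partial W^{-1}$, $\partial_{2k+1}W=-(L^{2k+1})_-W$ for all $k\ge0$, and $W^*\partial W=\partial$. Let $$\psi_{BA}(t,\lambda)=W\big(e^{\xi(t,\lambda)}\big)=\Big(1+\sum_{j\ge1}w_j(t)\lambda^{-j}\Big)e^{\xi(t,\lambda)},\qquad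 \xi(t,\lambda)=\sum_{k\ge0}t_{2k+1}\lambda^{2k+1},$$ be the wave function. Let $(\Phi_{1a})$, $(\Phi_{2a})$ be two finite families, with the same index set, of eigenfunctions, i.e. functions $\Phi$ with $\partial_{2k+1}\Phi=B_{2k+1}(\Phi)$ for all $k\ge0$. Let $n\ge0$ and suppose that $L$ satisfies the constraint of the constrained BKP hierarchy $$(L^{2n+1})_-=\sum_a\big(\Phi_{2a}\,\partial^{-1}\,\Phi_{1a,x}-\Phi_{1a}\,\partial^{-1}\,\Phi_{2a,x}\big)$$ (products of operators, functions acting by multiplication). Then, for two independent sets of times $t$ and $t'$, $$\int d\lambda\,\lambda^{2n}\,\psi_{BA}(t,\lambda)\,\psi_{BA}(t',-\lambda)=\sum_a\big[\Phi_{2a}(t')\Phi_{1a}(t)-\Phi_{1a}(t')\Phi_{2a}(t)\big],$$ where $\int d\lambda=\oint_\infty\frac{d\lambda}{2\pi i}$ is the formal residue, i.e. the coefficient of $\lambda^{-1}$; the integrand is a formal power series in $(t,t')$ whose coefficients are Laurent series in $\lambda^{-1}$, and the identity is one of formal power series in $(t,t')$. -/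

import Mathlib

noncomputable section

/-- Functions of the times `t = (t₁ = x, t₃, t₅, …)`, as formal power series over `R`.
The variable with index `k : ℕ` is the time `t_{2k+1}`. -/
abbrev TimeFun (R : Type*) : Type _ := MvPowerSeries ℕ R

namespace TimeFun

variable {R : Type*} [CommRing R]

/-- The derivative `∂_{2k+1} = ∂/∂t_{2k+1}`. -/
def dt (k : ℕ) (f : TimeFun R) : TimeFun R := MvPowerSeries.pderiv R k f

/-- The derivative `f ↦ f_x`, where `x = t₁`. -/
def dx (f : TimeFun R) : TimeFun R := dt 0 f

@[simp] theorem dt_zero (k : ℕ) : dt k (0 : TimeFun R) = 0 := map_zero _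

@[simp] theorem iterate_dx_zero (k : ℕ) : dx^[k] (0 : TimeFun R) = 0 := by
  induction k with
  | zero => rfl
  | succ k ih => rw [Function.iterate_succ_apply', ih]; exact dt_zero 0

end TimeFun

/-- Families `(a_i)_{i ∈ ℤ}` with `a_i = 0` for all large `i`. -/
def PsDO.coeffs (R : Type*) [CommRing R] : AddSubgroup (ℤ → TimeFun R) where
  carrier := {a | ∃ N : ℤ, ∀ i, N < i → a i = 0}
  add_mem' := by
    rintro a b ⟨N, hN⟩ ⟨M, hM⟩
    refine ⟨max N M, fun i hi => ?_⟩
    simp [hN i (lt_of_le_of_lt (le_max_left _ _) hi), hM i (lt_of_le_of_lt (le_max_right _ _) hi)]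
  zero_mem' := ⟨0, fun _ _ => rfl⟩
  neg_mem' := by
    rintro a ⟨N, hN⟩
    exact ⟨N, fun i hi => by simp [hN i hi]⟩

/-- Formal pseudodifferential operators `∑_{i ≤ N} a_i ∂^i` in `∂ = ∂/∂x` whose coefficients
are functions of the times. -/
def PsDO (R : Type*) [CommRing R] : Type _ := PsDO.coeffs R

namespace PsDO

open TimeFun

variable {R : Type*} [CommRing R]

instance : AddCommGroup (PsDO R) := inferInstanceAs (AddCommGroup (PsDO.coeffs R))

/-- The coefficient of `∂^i`. -/
def coeff (P : PsDO R) (i : ℤ) : TimeFun R := P.1 i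

theorem exists_bound (P : PsDO R) : ∃ N : ℤ, ∀ i, N < i → P.coeff i = 0 := P.2

/-- The operator with prescribed coefficients. -/
def mk (a : ℤ → TimeFun R) (h : ∃ N : ℤ, ∀ i, N < i → a i = 0) : PsDO R := ⟨a, h⟩

@[simp] theorem coeff_mk (a : ℤ → TimeFun R) (h) (i : ℤ) : (mk a h).coeff i = a i := rfl

@[ext] theorem ext {P Q : PsDO R} (h : ∀ i, P.coeff i = Q.coeff i) : P = Q :=
  Subtype.ext (funext h)

/-- The operator `f ∂^i`. -/
def monomial (i : ℤ) (f : TimeFun R) : PsDO R :=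
  mk (fun j => if j = i then f else 0) ⟨i, fun j hj => if_neg (by omega)⟩

/-- Multiplication by the function `f`, as an operator of order zero. -/
def fn (f : TimeFun R) : PsDO R := monomial 0 f

/-- The identity operator. -/
instance : One (PsDO R) := ⟨fn 1⟩

/-- The operator `∂`. -/
def d : PsDO R := monomial 1 1

/-- The operator `∂⁻¹`. -/
def dInv : PsDO R := monomial (-1) 1

/-- The composition, determined by the generalized Leibniz rule
`∂^i ∘ f = ∑_{k ≥ 0} (i choose k) f^{(k)} ∂^{i-k}`. The coefficient of `∂^m` in `P ∘ Q` is the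
sum of `(i choose k) P_i (Q_j)^{(k)}` over `i + j - k = m`; only finitely many terms of it are
nonzero (see `finite_support_mul`). -/
instance : Mul (PsDO R) where
  mul P Q := mk
    (fun m => ∑ᶠ s : ℤ × ℕ,
      Ring.choose s.1 s.2 • (P.coeff s.1 * dx^[s.2] (Q.coeff (m + s.2 - s.1)))) <| by
    obtain ⟨N, hN⟩ := P.exists_bound
    obtain ⟨M, hM⟩ := Q.exists_bound
    refine ⟨N + M, fun m hm => finsum_eq_zero_of_forall_eq_zero fun s => ?_⟩
    by_cases h : N < s.1
    · simp [hN _ h]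
    · simp [hM (m + s.2 - s.1) (by omega)]

theorem coeff_mul (P Q : PsDO R) (m : ℤ) : (P * Q).coeff m = ∑ᶠ s : ℤ × ℕ,
    Ring.choose s.1 s.2 • (P.coeff s.1 * dx^[s.2] (Q.coeff (m + s.2 - s.1))) := rfl

theorem finite_support_mul (P Q : PsDO R) (m : ℤ) : (Function.support fun s : ℤ × ℕ =>
    Ring.choose s.1 s.2 • (P.coeff s.1 * dx^[s.2] (Q.coeff (m + s.2 - s.1)))).Finite := by
  obtain ⟨N, hN⟩ := P.exists_bound
  obtain ⟨M, hM⟩ := Q.exists_bound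
  refine ((Set.finite_Icc (m - M) N).prod (Set.finite_Iic (N + M - m).toNat)).subset ?_
  intro s hs
  have h1 : ¬ N < s.1 := fun h => hs (by simp [hN _ h])
  have h2 : ¬ M < m + s.2 - s.1 := fun h => hs (by simp [hM _ h])
  simp only [Set.mem_prod, Set.mem_Icc, Set.mem_Iic]
  omega

/-- The powers `P^0 = 1`, `P^{k+1} = P^k ∘ P`. -/
instance : Pow (PsDO R) ℕ where
  pow P k := k.rec 1 fun _ Q => Q * P

theorem pow_zero (P : PsDO R) : P ^ 0 = 1 := rfl

theorem pow_succ (P : PsDO R) (k : ℕ) : P ^ (k + 1) = P ^ k * P := rfl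

/-- The formal adjoint `(∑ a_i ∂^i)^* = ∑ (-∂)^i ∘ a_i`. The coefficient of `∂^m` is
`∑_{k ≥ 0} (-1)^{m+k} (m+k choose k) (a_{m+k})^{(k)}`, a finite sum
(see `finite_support_adjoint`). -/
def adjoint (P : PsDO R) : PsDO R := mk
  (fun m => ∑ᶠ k : ℕ,
    ((Int.negOnePow (m + k) : ℤ) * Ring.choose (m + k : ℤ) k) • dx^[k] (P.coeff (m + k))) <| by
  obtain ⟨N, hN⟩ := P.exists_bound
  refine ⟨N, fun m hm => finsum_eq_zero_of_forall_eq_zero fun k => ?_⟩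
  simp [hN (m + k) (by omega)]

theorem finite_support_adjoint (P : PsDO R) (m : ℤ) : (Function.support fun k : ℕ =>
    ((Int.negOnePow (m + k) : ℤ) * Ring.choose (m + k : ℤ) k) •
      dx^[k] (P.coeff (m + k))).Finite := by
  obtain ⟨N, hN⟩ := P.exists_bound
  refine (Set.finite_Iic (N - m).toNat).subset fun k hk => ?_
  have h1 : ¬ N < m + k := fun h => hk (by simp [hN _ h])
  simp only [Set.mem_Iic]
  omega

/-- The differential part `P_+ = ∑_{i ≥ 0} a_i ∂^i`. -/
def posPart (P : PsDO R) : PsDO R := mk (fun i => if 0 ≤ i then P.coeff i else 0) <| by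
  obtain ⟨N, hN⟩ := P.exists_bound
  exact ⟨N, fun i hi => by simp [hN i hi]⟩

/-- The integral part `P_- = ∑_{i < 0} a_i ∂^i`. -/
def negPart (P : PsDO R) : PsDO R := mk (fun i => if i < 0 then P.coeff i else 0)
  ⟨0, fun i hi => if_neg (by omega)⟩

/-- The action `P(f) = ∑_{i ≥ 0} a_i f^{(i)}` of a differential operator on a function. -/
def applyFn (P : PsDO R) (f : TimeFun R) : TimeFun R := ∑ᶠ i : ℕ, P.coeff i * dx^[i] f

theorem finite_support_applyFn (P : PsDO R) (f : TimeFun R) :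
    (Function.support fun i : ℕ => P.coeff i * dx^[i] f).Finite := by
  obtain ⟨N, hN⟩ := P.exists_bound
  refine (Set.finite_Iic N.toNat).subset fun k hk => ?_
  have h1 : ¬ N < (k : ℤ) := fun h => hk (by simp [hN _ h])
  simp only [Set.mem_Iic]
  omega

/-- The derivative of the coefficients of `P` with respect to the time `t_{2k+1}`. -/
def dt (k : ℕ) (P : PsDO R) : PsDO R := mk (fun i => TimeFun.dt k (P.coeff i)) <| by
  obtain ⟨N, hN⟩ := P.exists_bound
  exact ⟨N, fun i hi => by simp [hN i hi]⟩

end PsDO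

namespace BKP

open TimeFun PsDO

variable {R : Type*} [CommRing R]

/-- The differential operator `B_{2k+1} = (L^{2k+1})_+`. -/
def B (L : PsDO R) (k : ℕ) : PsDO R := (L ^ (2 * k + 1)).posPart

/-- `L` is a solution of the BKP hierarchy: `L = ∂ + u₁ ∂⁻¹ + u₂ ∂⁻² + ⋯` satisfies the
constraint `L^* = -∂ L ∂⁻¹` and the Lax equations `∂_{2k+1} L = [B_{2k+1}, L]`. -/
structure IsSolution (L : PsDO R) : Prop where
  coeff_of_one_lt : ∀ i, 1 < i → L.coeff i = 0
  coeff_one : L.coeff 1 = 1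
  coeff_zero : L.coeff 0 = 0
  constraint : L.adjoint = -(d * L * dInv)
  lax : ∀ k, L.dt k = B L k * L - L * B L k

/-- `W = 1 + w₁ ∂⁻¹ + w₂ ∂⁻² + ⋯` is a dressing operator of the BKP Lax operator `L`:
`L = W ∂ W⁻¹` (written as `L W = W ∂`; an operator of the form of `W` is invertible),
`W` solves Sato's equations `∂_{2k+1} W = -(L^{2k+1})_- W`, and `W^* ∂ W = ∂`. -/
structure IsDressing (L W : PsDO R) : Prop where
  coeff_of_pos : ∀ i, 0 < i → W.coeff i = 0
  coeff_zero : W.coeff 0 = 1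
  dressing : L * W = W * d
  sato : ∀ k, W.dt k = -((L ^ (2 * k + 1)).negPart * W)
  constraint : W.adjoint * d * W = d

/-- `Φ` is an eigenfunction of the hierarchy: `∂_{2k+1} Φ = B_{2k+1}(Φ)` for all `k`. -/
def IsEigenfunction (L : PsDO R) (Φ : TimeFun R) : Prop :=
  ∀ k, TimeFun.dt k Φ = (B L k).applyFn Φ

/-- Formal series in the times (indexed by `σ`) whose coefficients are Laurent series in
`λ⁻¹`, that is, sums `∑_{i ≤ N} c_i λ^i`. Mathlib's Laurent variable plays the role of `λ⁻¹`. -/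
abbrev SpectralFun (σ R : Type*) [CommRing R] : Type _ := MvPowerSeries σ (LaurentSeries R)

/-- The power `λ^i`. -/
def lam (R : Type*) [CommRing R] (i : ℤ) : LaurentSeries R := HahnSeries.single (-i) 1

/-- The series `∑_i a_i(t) λ^i` attached to the operator `∑_i a_i ∂^i`. -/
def symbol (P : PsDO R) : SpectralFun ℕ R := fun m =>
  HahnSeries.ofSuppBddBelow (fun j => MvPowerSeries.coeff m (P.coeff (-j))) <| by
    obtain ⟨N, hN⟩ := P.exists_bound
    refine ⟨-N, fun j hj => ?_⟩
    by_contra h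
    exact hj (by simp [hN (-j) (by omega)])

/-- The exponential `e^{ξ(t,λ)}`, where `ξ(t,λ) = ∑_k t_{2k+1} λ^{2k+1}`: the coefficient of the
monomial `∏_k t_{2k+1}^{e_k}` is `∏_k λ^{(2k+1) e_k} / e_k!`. -/
def expXi (R : Type*) [CommRing R] [Algebra ℚ R] : SpectralFun ℕ R := fun m =>
  m.prod fun k e =>
    HahnSeries.C (algebraMap ℚ R (e.factorial : ℚ)⁻¹) * lam R (2 * k + 1) ^ e

/-- The Baker–Akhiezer wave function `ψ_BA(t,λ) = W(e^{ξ(t,λ)})`, where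
`∂^i e^{ξ(t,λ)} = λ^i e^{ξ(t,λ)}` for all integers `i`. -/
def waveFunction [Algebra ℚ R] (W : PsDO R) : SpectralFun ℕ R := symbol W * expXi R

/-- The substitution `λ ↦ -λ` in a Laurent series in `λ⁻¹`. -/
def negLamLaurent (f : LaurentSeries R) : LaurentSeries R :=
  HahnSeries.mk (fun j => (Int.negOnePow j : ℤ) • f.coeff j) <|
    f.isPWO_support.mono fun j hj h => hj (by simp [h])

/-- The substitution `λ ↦ -λ`. -/
def negLam {σ : Type*} (F : SpectralFun σ R) : SpectralFun σ R := fun m =>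
  negLamLaurent (MvPowerSeries.coeff m F)

/-- The residue `∫ dλ = ∮_∞ dλ/(2πi)`, normalized by `∫ dλ λ⁻¹ = 1`: the coefficient
of `λ⁻¹`, as a formal series in the times. -/
def residue {σ : Type*} (F : SpectralFun σ R) : MvPowerSeries σ R := fun m =>
  (MvPowerSeries.coeff m F).coeff 1

/-- `f(t)`, regarded as a function of the two independent sets of times `t` and `t'`. -/
def atT {A : Type*} [CommRing A] (f : MvPowerSeries ℕ A) : MvPowerSeries (ℕ ⊕ ℕ) A :=
  MvPowerSeries.rename (Function.Embedding.inl : ℕ ↪ ℕ ⊕ ℕ) f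

/-- `f(t')`, regarded as a function of the two independent sets of times `t` and `t'`. -/
def atT' {A : Type*} [CommRing A] (f : MvPowerSeries ℕ A) : MvPowerSeries (ℕ ⊕ ℕ) A :=
  MvPowerSeries.rename (Function.Embedding.inr : ℕ ↪ ℕ ⊕ ℕ) f

/-- The operator `∑_a (Φ_{2a} ∂⁻¹ Φ_{1a,x} - Φ_{1a} ∂⁻¹ Φ_{2a,x})`. -/
def ghostOperator {ι : Type*} [Fintype ι] (Φ₁ Φ₂ : ι → TimeFun R) : PsDO R :=
  ∑ a, (fn (Φ₂ a) * dInv * fn (dx (Φ₁ a)) - fn (Φ₁ a) * dInv * fn (dx (Φ₂ a)))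

end BKP

end

/-! Both sides of the identity, as functions of `t` with `t'` fixed, solve the linear system
`∂_{2k+1} F = B_{2k+1}(F)`. For the right side this is the eigenfunction property. The left side is
`pairing W (W ∂^{2n})`, and Sato's equations for `W` give the same evolution (`IsDressing.dt_add`,
`evolves_pairing`). The system expresses every time derivative through x-derivatives, so over a
torsion-free ring a solution vanishes as soon as all its x-derivatives vanish on the diagonal `t' =
t` (`Evolves.eq_zero`). It remains to compare the diagonal values of `∂_x^i`.

On the diagonal the exponentials cancel, and the residue in `λ` of `P(λ) Q(-λ)` is the residue of `P
Q^*` in `∂` (`residue_symbol_mul_negLam_symbol`). The left side thus becomes the coefficient of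
`∂^{-1}` in `∂^i W ∂^{2n} W^*`. Since `W^* ∂ W = ∂` gives `L^{2n+1} = W ∂^{2n} W^* ∂`
(`IsDressing.pow_eq`), this is the coefficient of `∂^0` in `∂^i L^{2n+1}`.

The differential part of `L^{2n+1}` contributes nothing, because a parity argument in `λ` kills its
term of order zero (`IsDressing.coeff_zero_pow`). The integral part is given by the constraint, and
`f ∂^{-1} g_x` contributes `(fg)^{(i)} - f^{(i)} g`. Antisymmetry cancels the terms `(Φ_1
Φ_2)^{(i)}` and leaves `Φ_2 Φ_1^{(i)} - Φ_1 Φ_2^{(i)}`, the diagonal value of the right side. -/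

noncomputable section

/-! ### Derivatives of functions of the times. -/

namespace TimeFun

variable {R : Type*} [CommRing R]

theorem dt_add (k : ℕ) (f g : TimeFun R) : dt k (f + g) = dt k f + dt k g := map_add _ _ _

theorem dt_mul (k : ℕ) (f g : TimeFun R) : dt k (f * g) = f * dt k g + dt k f * g := by
  simp only [dt, Derivation.leibniz, smul_eq_mul]
  ring

theorem dt_zsmul (k : ℕ) (n : ℤ) (f : TimeFun R) : dt k (n • f) = n • dt k f := map_zsmul _ _ _

theorem dt_comm (j k : ℕ) (f : TimeFun R) : dt j (dt k f) = dt k (dt j f) := by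
  rcases eq_or_ne j k with rfl | h
  · rfl
  ext n
  simp only [dt, MvPowerSeries.coeff_pderiv, Finsupp.add_apply, Finsupp.single_apply, if_neg h,
    if_neg h.symm, add_right_comm n]
  push_cast
  ring

theorem iterate_dx_succ (k : ℕ) (f : TimeFun R) : dx^[k + 1] f = dx (dx^[k] f) :=
  Function.iterate_succ_apply' _ _ _

theorem iterate_dx_add (k : ℕ) (f g : TimeFun R) : dx^[k] (f + g) = dx^[k] f + dx^[k] g := by
  induction k with
  | zero => rfl
  | succ k ih => simp only [iterate_dx_succ, ih, dx, dt_add]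

theorem dt_iterate_dx (j k : ℕ) (f : TimeFun R) : dt j (dx^[k] f) = dx^[k] (dt j f) := by
  induction k with
  | zero => rfl
  | succ k ih => rw [iterate_dx_succ, iterate_dx_succ, ← ih, dx, dt_comm, dx]

theorem iterate_dx_one {k : ℕ} (hk : k ≠ 0) : dx^[k] (1 : TimeFun R) = 0 := by
  obtain ⟨k, rfl⟩ := Nat.exists_eq_succ_of_ne_zero hk
  rw [Nat.succ_eq_add_one, Function.iterate_succ_apply]
  simp [dx, dt]

end TimeFun

/-! ### The associative algebra of pseudodifferential operators. -/

namespace PsDO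

open TimeFun

variable {R : Type*} [CommRing R]

/-- `P` has order at most `N`. -/
def OrdLE (P : PsDO R) (N : ℤ) : Prop := ∀ i, N < i → P.coeff i = 0

@[simp] theorem coeff_zero (i : ℤ) : (0 : PsDO R).coeff i = 0 := rfl

@[simp] theorem coeff_add (P Q : PsDO R) (i : ℤ) : (P + Q).coeff i = P.coeff i + Q.coeff i := rfl

@[simp] theorem coeff_sub (P Q : PsDO R) (i : ℤ) : (P - Q).coeff i = P.coeff i - Q.coeff i := rfl

theorem coeff_monomial (i j : ℤ) (f : TimeFun R) :
    (monomial i f).coeff j = if j = i then f else 0 := rfl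

theorem coeff_fn (f : TimeFun R) (j : ℤ) : (fn f).coeff j = if j = 0 then f else 0 := rfl

theorem coeff_dt (k : ℕ) (P : PsDO R) (i : ℤ) : (P.dt k).coeff i = TimeFun.dt k (P.coeff i) := rfl

theorem coeff_posPart (P : PsDO R) (i : ℤ) :
    P.posPart.coeff i = if 0 ≤ i then P.coeff i else 0 := rfl

theorem coeff_negPart (P : PsDO R) (i : ℤ) :
    P.negPart.coeff i = if i < 0 then P.coeff i else 0 := rfl

theorem posPart_add_negPart (P : PsDO R) : P.posPart + P.negPart = P := by
  ext1 i
  by_cases h : 0 ≤ i <;> simp [coeff_posPart, coeff_negPart, h, not_lt.2, not_le.1]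

theorem OrdLE.mul {P Q : PsDO R} {N M : ℤ} (hP : P.OrdLE N) (hQ : Q.OrdLE M) :
    (P * Q).OrdLE (N + M) := fun m hm => by
  rw [coeff_mul]
  refine finsum_eq_zero_of_forall_eq_zero fun s => ?_
  by_cases h : N < s.1
  · simp [hP _ h]
  · simp [hQ (m + s.2 - s.1) (by omega)]

theorem hasFiniteSupport_mul (P Q : PsDO R) (m : ℤ) : Function.HasFiniteSupport fun s : ℤ × ℕ =>
    Ring.choose s.1 s.2 • (P.coeff s.1 * dx^[s.2] (Q.coeff (m + s.2 - s.1))) :=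
  finite_support_mul P Q m

theorem mul_add (P Q S : PsDO R) : P * (Q + S) = P * Q + P * S := by
  ext1 m
  rw [coeff_add, coeff_mul, coeff_mul, coeff_mul,
    ← finsum_add_distrib (hasFiniteSupport_mul _ _ _) (hasFiniteSupport_mul _ _ _)]
  refine finsum_congr fun s => ?_
  rw [coeff_add, iterate_dx_add, _root_.mul_add, smul_add]

theorem add_mul (P Q S : PsDO R) : (P + Q) * S = P * S + Q * S := by
  ext1 m
  rw [coeff_add, coeff_mul, coeff_mul, coeff_mul,
    ← finsum_add_distrib (hasFiniteSupport_mul _ _ _) (hasFiniteSupport_mul _ _ _)]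
  refine finsum_congr fun s => ?_
  rw [coeff_add, _root_.add_mul, smul_add]

/-- Right multiplication by `∂^j` shifts the coefficients. -/
theorem coeff_mul_monomial_one (P : PsDO R) (j m : ℤ) :
    (P * monomial j 1).coeff m = P.coeff (m - j) := by
  rw [coeff_mul, finsum_eq_single _ ((m - j, 0) : ℤ × ℕ)]
  · simp [coeff_monomial]
  · rintro ⟨i, k⟩ h
    rcases eq_or_ne k 0 with rfl | hk
    · have : m - i ≠ j := by rintro rfl; simp at h
      simp [coeff_monomial, this]
    · simp only [coeff_monomial]
      split_ifs <;> simp [iterate_dx_one hk]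

theorem coeff_fn_mul (f : TimeFun R) (P : PsDO R) (m : ℤ) :
    (fn f * P).coeff m = f * P.coeff m := by
  rw [coeff_mul, finsum_eq_single _ ((0, 0) : ℤ × ℕ)]
  · simp [coeff_fn]
  · rintro ⟨i, k⟩ h
    rcases eq_or_ne i 0 with rfl | hi
    · have : k ≠ 0 := by rintro rfl; simp at h
      rw [Ring.choose_zero_pos ℤ (Nat.pos_of_ne_zero this), zero_smul]
    · simp [coeff_fn, hi]

theorem coeff_mul_d (P : PsDO R) (m : ℤ) : (P * d).coeff m = P.coeff (m - 1) :=
  coeff_mul_monomial_one P 1 m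

theorem choose_one_of_two_le {k : ℕ} (hk : 2 ≤ k) : Ring.choose (1 : ℤ) k = 0 := by
  rw [← Nat.cast_one, Ring.choose_natCast, Nat.choose_eq_zero_of_lt (by omega), Nat.cast_zero]

theorem coeff_d_mul (P : PsDO R) (m : ℤ) : (d * P).coeff m = dx (P.coeff m) + P.coeff (m - 1) := by
  rw [coeff_mul, finsum_eq_sum_of_support_subset (s := {((1, 1) : ℤ × ℕ), (1, 0)})]
  · rw [Finset.sum_pair (by simp)]
    simp [d, coeff_monomial]
  · rintro ⟨i, k⟩ h
    have hi : i = 1 := by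
      by_contra hi
      simp [d, coeff_monomial, hi] at h
    subst hi
    have : k < 2 := by
      by_contra hk
      simp [choose_one_of_two_le (not_lt.1 hk)] at h
    interval_cases k <;> simp

theorem d_mul (P : PsDO R) : d * P = P.dt 0 + P * d := by
  ext1 m
  rw [coeff_d_mul, coeff_add, coeff_mul_d]
  rfl

theorem one_mul (P : PsDO R) : 1 * P = P := by
  ext1 m
  exact (coeff_fn_mul _ _ _).trans (_root_.one_mul _)

theorem mul_one (P : PsDO R) : P * 1 = P := by
  ext1 m
  exact (coeff_mul_monomial_one P 0 m).trans (by simp)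

theorem fn_mul_mul (f : TimeFun R) (P Q : PsDO R) : fn f * P * Q = fn f * (P * Q) := by
  ext1 m
  rw [coeff_fn_mul, coeff_mul, coeff_mul, mul_finsum' _ _ (hasFiniteSupport_mul P Q m)]
  refine finsum_congr fun s => ?_
  rw [coeff_fn_mul, _root_.mul_assoc, mul_smul_comm]

theorem mul_mul_monomial_one (P Q : PsDO R) (j : ℤ) :
    P * Q * monomial j 1 = P * (Q * monomial j 1) := by
  ext1 m
  rw [coeff_mul_monomial_one, coeff_mul, coeff_mul]
  refine finsum_congr fun s => ?_
  rw [coeff_mul_monomial_one]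
  congr 4
  ring

theorem dt_mul (k : ℕ) (P Q : PsDO R) : (P * Q).dt k = P.dt k * Q + P * Q.dt k := by
  ext1 m
  rw [coeff_add, coeff_dt, coeff_mul, coeff_mul, coeff_mul,
    ← finsum_add_distrib (hasFiniteSupport_mul _ _ _) (hasFiniteSupport_mul _ _ _)]
  change (MvPowerSeries.pderiv R k).toLinearMap.toAddMonoidHom _ = _
  rw [AddMonoidHom.map_finsum _ (hasFiniteSupport_mul P Q m)]
  refine finsum_congr fun s => ?_
  change TimeFun.dt k _ = _
  rw [dt_zsmul, TimeFun.dt_mul, dt_iterate_dx, smul_add, coeff_dt, coeff_dt, add_comm]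

/-- This is Pascal's rule for generalized binomial coefficients. It is the base case from which
associativity is built. -/
theorem mul_d_mul (P Q : PsDO R) : P * d * Q = P * (d * Q) := by
  ext1 m
  set F : ℤ × ℕ → TimeFun R := fun s =>
    Ring.choose s.1 s.2 • (P.coeff s.1 * dx^[s.2] (Q.coeff (m - 1 + s.2 - s.1))) with hF
  set G : ℤ × ℕ → TimeFun R := fun s =>
    Ring.choose s.1 s.2 • (P.coeff s.1 * dx^[s.2] (dx (Q.coeff (m + s.2 - s.1)))) with hG
  set H : ℤ × ℕ → TimeFun R := fun s =>
    Ring.choose (s.1 + 1) s.2 • (P.coeff s.1 * dx^[s.2] (Q.coeff (m - 1 + s.2 - s.1))) with hH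
  have hFs : F.support.Finite := finite_support_mul P Q (m - 1)
  have hGs : G.support.Finite := finite_support_mul P (Q.dt 0) m
  have hR : (P * (d * Q)).coeff m = ∑ᶠ s, F s + ∑ᶠ s, G s := by
    rw [← finsum_add_distrib hFs hGs, coeff_mul]
    refine finsum_congr fun s => ?_
    rw [coeff_d_mul, iterate_dx_add, _root_.mul_add, smul_add, add_comm, hF, hG]
    congr 5
    ring
  have hL : (P * d * Q).coeff m = ∑ᶠ s, H s := by
    rw [coeff_mul, ← finsum_comp_equiv ((Equiv.addRight (1 : ℤ)).prodCongr (Equiv.refl ℕ))]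
    refine finsum_congr fun s => ?_
    simp only [hH, Equiv.prodCongr_apply, Prod.map, Equiv.coe_addRight, Equiv.refl_apply,
      coeff_mul_d, add_sub_cancel_right]
    congr 4
    ring
  -- Shifting `k` to `k + 1` in the sum `G` aligns it with `F` and `H`, so that Pascal's rule
  -- applies term by term.
  let e : ℤ × ℕ → ℤ × ℕ := fun s => (s.1, s.2 + 1)
  have he : Function.Injective e := fun s t h => by
    simp only [e, Prod.mk.injEq, add_left_inj] at h
    exact Prod.ext h.1 h.2
  let G' : ℤ × ℕ → TimeFun R := fun s => if s.2 = 0 then 0 else G (s.1, s.2 - 1)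
  have hG' : ∀ s, G' (e s) = G s := fun s => by simp [G', e]
  have hsupp : G'.support ⊆ Set.range e := fun s hs => by
    have : s.2 ≠ 0 := fun h => hs (by simp [G', h])
    exact ⟨(s.1, s.2 - 1), Prod.ext rfl (Nat.succ_pred_eq_of_ne_zero this)⟩
  have hGG' : ∑ᶠ s, G s = ∑ᶠ s, G' s := by
    rw [← finsum_mem_univ (f := G'), ← finsum_mem_inter_support, Set.univ_inter,
      ← finsum_congr hG', ← finsum_mem_range he]
    refine (finsum_mem_inter_support _ _).symm.trans ?_
    rw [Set.inter_eq_right.2 hsupp]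
  have hG's : G'.support.Finite := by
    refine (hGs.image e).subset fun s hs => ?_
    obtain ⟨t, rfl⟩ := hsupp hs
    exact ⟨t, by simpa [hG'] using hs, rfl⟩
  rw [hL, hR, hGG', ← finsum_add_distrib hFs hG's]
  refine finsum_congr fun s => ?_
  obtain ⟨i, k⟩ := s
  cases k with
  | zero => simp [hF, hH, G']
  | succ k =>
    simp only [hF, hH, hG, G', Nat.add_one_ne_zero, if_false, Nat.add_sub_cancel]
    rw [Ring.choose_succ_succ, add_smul, add_comm, ← Function.iterate_succ_apply dx]
    congr 6
    push_cast
    ring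

theorem d_mul_mul (P Q : PsDO R) : d * P * Q = d * (P * Q) := by
  rw [d_mul, add_mul, mul_d_mul, d_mul, mul_add, d_mul, dt_mul, add_assoc]
  congr 2
  exact (mul_mul_monomial_one P Q 1).symm

/-- The leading coefficient of `∂P` is that of `P`, so the coefficients of `P` vanish one after
another from the top. -/
theorem eq_zero_of_d_mul {P : PsDO R} (h : d * P = 0) : P = 0 := by
  obtain ⟨N, hN⟩ := P.exists_bound
  have key : ∀ n : ℕ, ∀ i, N - n < i → P.coeff i = 0 := by
    intro n
    induction n with
    | zero => simpa using hN
    | succ n ih =>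
      intro i hi
      have h1 := congrArg (fun X => coeff X (i + 1)) h
      simp only [coeff_d_mul, ih (i + 1) (by push_cast at hi; omega), add_sub_cancel_right,
        coeff_zero, dx, TimeFun.dt_zero, zero_add] at h1
      exact h1
  ext1 i
  exact key (N - i + 1).toNat i (by omega)

theorem monomial_mul_monomial_one (i j : ℤ) (f : TimeFun R) :
    monomial i f * monomial j 1 = monomial (i + j) f := by
  ext1 m
  rw [coeff_mul_monomial_one, coeff_monomial, coeff_monomial]
  simp only [sub_eq_iff_eq_add]

theorem fn_mul_monomial_one (j : ℤ) (f : TimeFun R) : fn f * monomial j 1 = monomial j f :=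
  (monomial_mul_monomial_one 0 j f).trans (by rw [zero_add])

theorem eq_of_d_mul_eq_d_mul {P Q : PsDO R} (h : d * P = d * Q) : P = Q := by
  have h1 : d * (P - Q) + d * Q = d * Q := by rw [← mul_add, sub_add_cancel, h]
  exact sub_eq_zero.1 (eq_zero_of_d_mul (by simpa using h1))

/-- Positive powers follow by peeling off factors `∂`; negative powers follow by cancelling a `∂` on
the left. -/
theorem monomial_one_mul_mul (i : ℤ) (P Q : PsDO R) :
    monomial i 1 * P * Q = monomial i 1 * (P * Q) := by
  induction i using Int.induction_on generalizing P with
  | zero => exact fn_mul_mul 1 P Q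
  | succ i ih =>
    have h : monomial (i + 1) 1 = monomial (R := R) i 1 * d := (monomial_mul_monomial_one i 1 1).symm
    rw [h, mul_d_mul, mul_d_mul, ih, d_mul_mul]
  | pred i ih =>
    have h : monomial (-i) 1 = d * monomial (R := R) (-i - 1) 1 := by
      rw [d, monomial_mul_monomial_one]; congr 1; ring
    apply eq_of_d_mul_eq_d_mul
    rw [← d_mul_mul, ← d_mul_mul, ← d_mul_mul, ← h, ih]

theorem monomial_mul_mul (i : ℤ) (f : TimeFun R) (P Q : PsDO R) :
    monomial i f * P * Q = monomial i f * (P * Q) := by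
  rw [← fn_mul_monomial_one, fn_mul_mul, fn_mul_mul, fn_mul_mul, monomial_one_mul_mul]

/-- An additive map that vanishes on operators of low order and on monomials is zero. -/
theorem addMonoidHom_eq_zero {A : Type*} [AddCommGroup A] (φ : PsDO R →+ A) (N : ℤ)
    (h0 : ∀ P : PsDO R, P.OrdLE N → φ P = 0) (h1 : ∀ i f, φ (monomial i f) = 0) (P : PsDO R) :
    φ P = 0 := by
  have key : ∀ n : ℕ, ∀ P : PsDO R, P.OrdLE (N + n) → φ P = 0 := by
    intro n
    induction n with
    | zero => simpa using h0
    | succ n ih =>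
      intro P hP
      have h2 : φ (P - monomial (N + (n + 1 : ℕ)) (P.coeff (N + (n + 1 : ℕ)))) = 0 := by
        refine ih _ fun i hi => ?_
        rw [coeff_sub, coeff_monomial]
        split_ifs with h
        · rw [h, sub_self]
        · rw [hP i (by push_cast at h ⊢; omega), sub_zero]
      rwa [map_sub, h1, sub_zero] at h2
  obtain ⟨M, hM⟩ := P.exists_bound
  exact key (M - N).toNat P fun i hi => hM i (by omega)

theorem mul_assoc (P Q S : PsDO R) : P * Q * S = P * (Q * S) := by
  ext1 m
  obtain ⟨M, hM⟩ := Q.exists_bound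
  obtain ⟨K, hK⟩ := S.exists_bound
  -- For fixed `m`, `Q`, `S` the associator is additive in `P`. It vanishes when `P` has order below
  -- `m - M - K`, as both products then have order below `m`, so monomials suffice.
  let φ : PsDO R →+ TimeFun R := AddMonoidHom.mk' (fun P => (P * Q * S).coeff m - (P * (Q * S)).coeff m)
    fun P P' => by simp only [add_mul, coeff_add]; ring
  refine sub_eq_zero.1 (addMonoidHom_eq_zero φ (m - M - K - 1) (fun P hP => ?_) (fun i f => ?_) P)
  · have h1 := (hP.mul hM).mul hK m (by omega)
    have h2 := hP.mul (OrdLE.mul hM hK) m (by omega)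
    simp [φ, h1, h2]
  · simp [φ, monomial_mul_mul]

end PsDO

/-! ### Formal adjoints and the residue in `∂`. -/

namespace PsDO

open TimeFun

variable {R : Type*} [CommRing R]

theorem hasFiniteSupport_adjoint (P : PsDO R) (m : ℤ) : Function.HasFiniteSupport fun k : ℕ =>
    ((Int.negOnePow (m + k) : ℤ) * Ring.choose (m + k : ℤ) k) • dx^[k] (P.coeff (m + k)) :=
  finite_support_adjoint P m

theorem adjoint_add (P Q : PsDO R) : (P + Q).adjoint = P.adjoint + Q.adjoint := by
  ext1 m
  simp only [adjoint, coeff_mk, coeff_add]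
  rw [← finsum_add_distrib (hasFiniteSupport_adjoint _ _) (hasFiniteSupport_adjoint _ _)]
  refine finsum_congr fun k => ?_
  rw [iterate_dx_add, smul_add]

theorem OrdLE.adjoint {P : PsDO R} {N : ℤ} (hP : P.OrdLE N) : P.adjoint.OrdLE N := fun m hm =>
  finsum_eq_zero_of_forall_eq_zero fun k => by simp [hP (m + k) (by omega)]

theorem coeff_monomial_one_mul_fn (j m : ℤ) (q : TimeFun R) :
    (monomial j 1 * fn q).coeff m =
      if m ≤ j then Ring.choose j (j - m).toNat • dx^[(j - m).toNat] q else 0 := by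
  rw [coeff_mul, finsum_eq_single _ ((j, (j - m).toNat) : ℤ × ℕ)]
  · simp only [coeff_monomial, if_true, _root_.one_mul, coeff_fn]
    split_ifs with h1 h2 h2
    · rfl
    · omega
    · omega
    · simp
  · rintro ⟨i, k⟩ h
    rcases eq_or_ne i j with rfl | hi
    · have : ¬ m + k - i = 0 := fun h0 => h (Prod.ext rfl (by simp; omega))
      simp [coeff_fn, this]
    · simp [coeff_monomial, hi]

theorem adjoint_monomial (j : ℤ) (q : TimeFun R) :
    (monomial j q).adjoint = fn ((j.negOnePow : ℤ) : TimeFun R) * (monomial j 1 * fn q) := by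
  ext1 m
  rw [coeff_fn_mul, coeff_monomial_one_mul_fn]
  simp only [adjoint, coeff_mk]
  rw [finsum_eq_single _ (j - m).toNat]
  · split_ifs with h
    · have : m + ((j - m).toNat : ℤ) = j := by omega
      rw [this, coeff_monomial, if_pos rfl, mul_smul, ← zsmul_eq_mul]
    · rw [coeff_monomial, if_neg (by omega)]
      simp
  · intro k hk
    rw [coeff_monomial, if_neg (by omega)]
    simp

/-- For `j < -1` the order is too low, and for `j ≥ 0` the product is a differential operator. -/
theorem coeff_neg_one_monomial_mul_fn (j : ℤ) (q : TimeFun R) :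
    (monomial j 1 * fn q).coeff (-1) = if j = -1 then q else 0 := by
  rw [coeff_monomial_one_mul_fn]
  rcases lt_trichotomy j (-1) with h | rfl | h
  · rw [if_neg (by omega), if_neg (by omega)]
  · simp
  · rw [if_pos (by omega), if_neg (by omega)]
    lift j to ℕ using by omega
    rw [Ring.choose_natCast, Nat.choose_eq_zero_of_lt (by omega)]
    simp

/-- The residue of `∂^i ∘ Q^*` is, up to sign, a single coefficient of `Q`. -/
theorem coeff_monomial_mul_adjoint (i : ℤ) (Q : PsDO R) :
    (monomial i 1 * Q.adjoint).coeff (-1) =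
      ((Int.negOnePow (-1 - i) : ℤ) : TimeFun R) * Q.coeff (-1 - i) := by
  let φ : PsDO R →+ TimeFun R := AddMonoidHom.mk' (fun Q =>
      (monomial i 1 * Q.adjoint).coeff (-1) -
        ((Int.negOnePow (-1 - i) : ℤ) : TimeFun R) * Q.coeff (-1 - i))
    fun P P' => by simp only [adjoint_add, mul_add, coeff_add]; ring
  refine sub_eq_zero.1 (addMonoidHom_eq_zero φ (-2 - i) (fun P hP => ?_) (fun j q => ?_) Q)
  · have h0 : (monomial (R := R) i 1).OrdLE i := fun j hj => if_neg (by omega)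
    have h1 := h0.mul hP.adjoint (-1) (by omega)
    simp [φ, h1, hP (-1 - i) (by omega)]
  · have h : (monomial i 1 * (fn ((j.negOnePow : ℤ) : TimeFun R) * (monomial j 1 * fn q))) =
        fn ((j.negOnePow : ℤ) : TimeFun R) * (monomial (i + j) 1 * fn q) := by
      -- The sign is a constant, hence commutes with every power of `∂`.
      have h2 : monomial i 1 * fn ((j.negOnePow : ℤ) : TimeFun R) =
          fn ((j.negOnePow : ℤ) : TimeFun R) * monomial i 1 := by
        rcases Int.units_eq_one_or j.negOnePow with h | h
        · rw [h]
          simp only [Units.val_one, Int.cast_one]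
          exact (mul_one _).trans (one_mul _).symm
        · rw [h]
          ext1 m
          rw [coeff_fn_mul, coeff_monomial_one_mul_fn, coeff_monomial]
          split_ifs with h3 h4 h4
          · subst h4; simp
          · have : (i - m).toNat ≠ 0 := by omega
            obtain ⟨k, hk⟩ := Nat.exists_eq_succ_of_ne_zero this
            rw [hk, Nat.succ_eq_add_one, Function.iterate_succ_apply]
            simp [dx, TimeFun.dt]
          · omega
          · simp
      rw [← mul_assoc, h2, mul_assoc, ← mul_assoc (monomial i 1), monomial_mul_monomial_one]
    simp only [φ, AddMonoidHom.mk'_apply, adjoint_monomial, h, coeff_fn_mul, coeff_neg_one_monomial_mul_fn,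
      coeff_monomial]
    split_ifs with h1 h2 h2
    · rw [h2, sub_self]
    · omega
    · omega
    · simp

end PsDO

/-! ### Symbols and the residue in `λ`. -/

namespace BKP

open TimeFun PsDO

variable {R : Type*} [CommRing R]

theorem coeff_negLamLaurent (f : LaurentSeries R) (j : ℤ) :
    (negLamLaurent f).coeff j = (Int.negOnePow j : ℤ) • f.coeff j := rfl

theorem support_negLamLaurent (f : LaurentSeries R) : (negLamLaurent f).support = f.support := by
  ext j
  simp only [HahnSeries.mem_support, coeff_negLamLaurent]
  rcases Int.units_eq_one_or j.negOnePow with h | h <;> simp [h]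

theorem negLamLaurent_mul (f g : LaurentSeries R) :
    negLamLaurent (f * g) = negLamLaurent f * negLamLaurent g := by
  ext j
  rw [coeff_negLamLaurent, HahnSeries.coeff_mul, HahnSeries.coeff_mul, Finset.smul_sum]
  refine Finset.sum_congr ?_ fun p hp => ?_
  · ext p
    rw [Finset.mem_antidiagonal, Finset.mem_antidiagonal, support_negLamLaurent,
      support_negLamLaurent]
  · rw [coeff_negLamLaurent, coeff_negLamLaurent, ← (Finset.mem_antidiagonal.1 hp).2.2,
      Int.negOnePow_add, Units.val_mul, smul_mul_smul_comm]

/-- The substitution `λ ↦ -λ` as a ring homomorphism. -/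
def negLamHom (R : Type*) [CommRing R] : LaurentSeries R →+* LaurentSeries R where
  toFun := negLamLaurent
  map_one' := by
    ext j
    rw [coeff_negLamLaurent, HahnSeries.coeff_one]
    split_ifs with h <;> simp [h]
  map_mul' := negLamLaurent_mul
  map_zero' := by ext j; simp [coeff_negLamLaurent]
  map_add' f g := by ext j; simp [coeff_negLamLaurent]

theorem coeff_negLamHom (f : LaurentSeries R) (j : ℤ) :
    (negLamHom R f).coeff j = (Int.negOnePow j : ℤ) • f.coeff j := rfl

theorem negLam_eq_map {σ : Type*} (F : SpectralFun σ R) :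
    negLam F = MvPowerSeries.map (negLamHom R) F := rfl

theorem negLamHom_lam (i : ℤ) : negLamHom R (lam R i) = HahnSeries.C ((i.negOnePow : ℤ) : R) * lam R i := by
  ext j
  rw [coeff_negLamHom, HahnSeries.C_mul_eq_smul, HahnSeries.coeff_smul, lam]
  rcases eq_or_ne j (-i) with rfl | h
  · simp [Int.negOnePow_neg]
  · simp [HahnSeries.coeff_single_of_ne h]

section residue

variable {σ : Type*}

theorem coeff_residue (F : SpectralFun σ R) (m : σ →₀ ℕ) :
    MvPowerSeries.coeff m (residue F) = (MvPowerSeries.coeff m F).coeff 1 := rfl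

theorem residue_add (F G : SpectralFun σ R) : residue (F + G) = residue F + residue G := rfl

theorem residue_map_C_mul (f : MvPowerSeries σ R) (F : SpectralFun σ R) :
    residue (MvPowerSeries.map HahnSeries.C f * F) = f * residue F := by
  classical
  ext m
  rw [coeff_residue, MvPowerSeries.coeff_mul, MvPowerSeries.coeff_mul, HahnSeries.coeff_sum]
  refine Finset.sum_congr rfl fun p _ => ?_
  rw [MvPowerSeries.coeff_map, HahnSeries.C_mul_eq_smul, HahnSeries.coeff_smul, smul_eq_mul,
    coeff_residue]

theorem pderiv_residue (k : σ) (F : SpectralFun σ R) :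
    MvPowerSeries.pderiv R k (residue F) =
      residue (MvPowerSeries.pderiv (LaurentSeries R) k F) := by
  ext m
  rw [MvPowerSeries.coeff_pderiv, coeff_residue, coeff_residue, MvPowerSeries.coeff_pderiv,
    mul_comm, mul_comm (MvPowerSeries.coeff _ _)]
  have h : ((m k : LaurentSeries R) + 1) = HahnSeries.C ((m k : R) + 1) := by
    rw [map_add, map_natCast, map_one]
  rw [h, HahnSeries.C_mul_eq_smul, HahnSeries.coeff_smul, smul_eq_mul]

theorem rename_residue {τ : Type*} (e : σ → τ) [Filter.TendstoCofinite e] (F : SpectralFun σ R) :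
    MvPowerSeries.rename e (residue F) = residue (MvPowerSeries.rename e F) := by
  ext m
  rw [coeff_residue, MvPowerSeries.coeff_rename, MvPowerSeries.coeff_rename, HahnSeries.coeff_sum]
  rfl

theorem residue_negLam (F : SpectralFun σ R) : residue (negLam F) = -residue F := by
  ext m
  rw [coeff_residue, map_neg, coeff_residue, negLam_eq_map, MvPowerSeries.coeff_map,
    coeff_negLamHom]
  simp

theorem negLam_negLam (F : SpectralFun σ R) : negLam (negLam F) = F := by
  ext m j
  simp only [negLam_eq_map, MvPowerSeries.coeff_map, coeff_negLamHom, smul_smul]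
  rw [← Units.val_mul, Int.units_mul_self]
  simp

end residue

theorem pderiv_map {σ A B : Type*} [CommRing A] [CommRing B] (φ : A →+* B) (k : σ)
    (F : MvPowerSeries σ A) : MvPowerSeries.pderiv B k (MvPowerSeries.map φ F) =
      MvPowerSeries.map φ (MvPowerSeries.pderiv A k F) := by
  ext m
  simp [MvPowerSeries.coeff_pderiv]

theorem coeff_symbol (P : PsDO R) (m : ℕ →₀ ℕ) (j : ℤ) :
    (MvPowerSeries.coeff m (symbol P)).coeff j = MvPowerSeries.coeff m (P.coeff (-j)) := rfl

theorem symbol_add (P Q : PsDO R) : symbol (P + Q) = symbol P + symbol Q := by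
  ext m j
  simp [coeff_symbol]

theorem symbol_fn_mul (f : TimeFun R) (P : PsDO R) :
    symbol (fn f * P) = MvPowerSeries.map HahnSeries.C f * symbol P := by
  classical
  ext m j
  rw [coeff_symbol, coeff_fn_mul, MvPowerSeries.coeff_mul, MvPowerSeries.coeff_mul,
    HahnSeries.coeff_sum]
  refine Finset.sum_congr rfl fun p _ => ?_
  rw [MvPowerSeries.coeff_map, HahnSeries.C_mul_eq_smul, HahnSeries.coeff_smul, smul_eq_mul,
    coeff_symbol]

theorem coeff_lam_mul (i : ℤ) (f : LaurentSeries R) (j : ℤ) :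
    (lam R i * f).coeff j = f.coeff (j + i) := by
  rw [lam, HahnSeries.coeff_single_mul, _root_.one_mul, sub_neg_eq_add]

theorem symbol_mul_monomial_one (P : PsDO R) (i : ℤ) :
    symbol (P * monomial i 1) = MvPowerSeries.C (lam R i) * symbol P := by
  ext m j
  rw [coeff_symbol, coeff_mul_monomial_one, MvPowerSeries.coeff_C_mul, coeff_lam_mul,
    coeff_symbol, neg_add']

theorem pderiv_symbol (k : ℕ) (P : PsDO R) :
    MvPowerSeries.pderiv (LaurentSeries R) k (symbol P) = symbol (P.dt k) := by
  ext m j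
  rw [coeff_symbol, coeff_dt, TimeFun.dt, MvPowerSeries.coeff_pderiv, MvPowerSeries.coeff_pderiv,
    mul_comm, mul_comm (MvPowerSeries.coeff _ _), ← coeff_symbol]
  have h : ((m k : LaurentSeries R) + 1) = HahnSeries.C ((m k : R) + 1) := by
    rw [map_add, map_natCast, map_one]
  rw [h, HahnSeries.C_mul_eq_smul, HahnSeries.coeff_smul, smul_eq_mul]

theorem residue_lam_mul_negLam_symbol (i : ℤ) (Q : PsDO R) :
    residue (MvPowerSeries.C (lam R i) * negLam (symbol Q)) =
      ((Int.negOnePow (-1 - i) : ℤ) : TimeFun R) * Q.coeff (-1 - i) := by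
  ext m
  rw [coeff_residue, MvPowerSeries.coeff_C_mul, coeff_lam_mul, negLam_eq_map,
    MvPowerSeries.coeff_map, coeff_negLamHom, coeff_symbol, ← zsmul_eq_mul, map_zsmul,
    show -(1 + i) = -1 - i by ring, ← Int.negOnePow_neg (1 + i), neg_add']

/-- The residue of `P(λ) Q(-λ)` in `λ` is the residue of `P Q^*` in `∂`. -/
theorem residue_symbol_mul_negLam_symbol (P Q : PsDO R) :
    residue (symbol P * negLam (symbol Q)) = (P * Q.adjoint).coeff (-1) := by
  obtain ⟨M, hM⟩ := Q.exists_bound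
  let φ : PsDO R →+ TimeFun R := AddMonoidHom.mk' (fun P =>
      residue (symbol P * negLam (symbol Q)) - (P * Q.adjoint).coeff (-1))
    fun P P' => by
      simp only [symbol_add, PsDO.add_mul, _root_.add_mul, PsDO.coeff_add, residue_add]; ring
  -- Since `Q` has order at most `M`, an operator `P` of order at most `-2 - M` makes both sides
  -- start at degree `-2` or lower.
  refine sub_eq_zero.1 (addMonoidHom_eq_zero φ (-2 - M) (fun P hP => ?_) (fun i f => ?_) P)
  · have h1 := hP.mul (OrdLE.adjoint hM) (-1) (by omega)
    have h2 : residue (symbol P * negLam (symbol Q)) = 0 := by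
      classical
      ext m
      rw [coeff_residue, MvPowerSeries.coeff_mul, HahnSeries.coeff_sum, map_zero]
      refine Finset.sum_eq_zero fun p _ => ?_
      rw [HahnSeries.coeff_mul]
      refine Finset.sum_eq_zero fun q hq => ?_
      have hq1 := (Finset.mem_antidiagonal.1 hq).2.2
      rw [coeff_symbol, negLam_eq_map, MvPowerSeries.coeff_map, coeff_negLamHom, coeff_symbol]
      by_cases h : -2 - M < -q.1
      · simp [hP _ h]
      · simp [hM (-q.2) (by omega)]
    simp [φ, h1, h2]
  · have h3 : symbol (monomial i f) = MvPowerSeries.map HahnSeries.C f * MvPowerSeries.C (lam R i) := by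
      have h4 : symbol (fn f) = MvPowerSeries.map HahnSeries.C f := by
        ext m j
        rw [coeff_symbol, coeff_fn, MvPowerSeries.coeff_map]
        rcases eq_or_ne j 0 with rfl | h
        · simp
        · simp [HahnSeries.C_apply, HahnSeries.coeff_single_of_ne h, h]
      rw [← fn_mul_monomial_one, symbol_mul_monomial_one, h4, mul_comm]
    simp only [φ, AddMonoidHom.mk'_apply]
    rw [h3, _root_.mul_assoc, residue_map_C_mul, residue_lam_mul_negLam_symbol,
      ← fn_mul_monomial_one, fn_mul_mul, coeff_fn_mul, coeff_monomial_mul_adjoint, sub_self]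

/-! ### The exponential of `ξ(t, λ)`. -/

section exponential

variable [Algebra ℚ R]

theorem isAddTorsionFree_of_algebra_rat (A : Type*) [CommRing A] [Algebra ℚ A] :
    IsAddTorsionFree A := IsAddTorsionFree.of_module_rat A

theorem coeff_expXi (m : ℕ →₀ ℕ) : MvPowerSeries.coeff m (expXi R) = m.prod fun k e =>
    HahnSeries.C (algebraMap ℚ R (e.factorial : ℚ)⁻¹) * lam R (2 * k + 1) ^ e := rfl

theorem pderiv_expXi (k : ℕ) : MvPowerSeries.pderiv (LaurentSeries R) k (expXi R) =
    MvPowerSeries.C (lam R (2 * k + 1)) * expXi R := by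
  classical
  ext1 m
  rw [MvPowerSeries.coeff_pderiv, MvPowerSeries.coeff_C_mul, coeff_expXi, coeff_expXi]
  set s := insert k m.support
  have h1 : (m + Finsupp.single k 1).support ⊆ s := fun i hi => by
    rcases eq_or_ne i k with rfl | h
    · simp [s]
    · simpa [s, h, Finsupp.single_apply, h.symm] using hi
  rw [Finsupp.prod_of_support_subset _ h1 _ (by simp),
    Finsupp.prod_of_support_subset m (Finset.subset_insert _ _ : m.support ⊆ s) _ (by simp),
    ← Finset.mul_prod_erase s _ (Finset.mem_insert_self k _),
    ← Finset.mul_prod_erase s _ (Finset.mem_insert_self k _)]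
  have h2 : ∀ i ∈ s.erase k, (m + Finsupp.single k 1 : ℕ →₀ ℕ) i = m i := fun i hi => by
    simp [(Finset.ne_of_mem_erase hi).symm]
  rw [Finset.prod_congr rfl fun i hi => by rw [h2 i hi]]
  have h3 : ((m k : LaurentSeries R) + 1) = HahnSeries.C (algebraMap ℚ R (m k + 1)) := by
    simp only [map_add, map_natCast, map_one]
  have h4 : algebraMap ℚ R ((m k + 1).factorial : ℚ)⁻¹ * algebraMap ℚ R (m k + 1) =
      algebraMap ℚ R ((m k).factorial : ℚ)⁻¹ := by
    rw [← map_mul, Nat.factorial_succ]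
    congr 1
    push_cast
    field_simp
  rw [h3, ← h4, map_mul]
  simp only [Finsupp.add_apply, Finsupp.single_eq_same, _root_.pow_succ]
  ring

/-- As `ξ` is odd in `λ`, the two logarithmic derivatives are opposite. The product has zero
derivatives and constant term 1. -/
theorem expXi_mul_negLam_expXi : expXi R * negLam (expXi R) = 1 := by
  have : IsAddTorsionFree (LaurentSeries R) := isAddTorsionFree_of_algebra_rat _
  refine MvPowerSeries.pderiv.ext (fun k => ?_) ?_
  · rw [Derivation.leibniz, negLam_eq_map, pderiv_map, pderiv_expXi, map_mul, MvPowerSeries.map_C,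
      negLamHom_lam, Int.negOnePow_odd _ ⟨k, rfl⟩, MvPowerSeries.pderiv_one]
    simp only [Units.val_neg, Units.val_one, Int.cast_neg, Int.cast_one, map_neg, map_one,
      smul_eq_mul, neg_mul, _root_.one_mul]
    ring
  · rw [map_mul, negLam_eq_map, MvPowerSeries.constantCoeff_map,
      ← MvPowerSeries.coeff_zero_eq_constantCoeff_apply, coeff_expXi]
    simp

end exponential

end BKP

/-! ### Zeroth-order coefficients of operator products. -/

namespace PsDO

open TimeFun

variable {R : Type*} [CommRing R]

theorem coeff_sum {ι : Type*} (s : Finset ι) (P : ι → PsDO R) (i : ℤ) :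
    (∑ a ∈ s, P a).coeff i = ∑ a ∈ s, (P a).coeff i :=
  map_sum (AddMonoidHom.mk' (fun P : PsDO R => P.coeff i) fun _ _ => rfl) P s

theorem sum_mul {ι : Type*} (s : Finset ι) (P : ι → PsDO R) (Q : PsDO R) :
    (∑ a ∈ s, P a) * Q = ∑ a ∈ s, P a * Q :=
  map_sum (AddMonoidHom.mk' (fun P : PsDO R => P * Q) fun _ _ => add_mul _ _ _) P s

theorem mul_sum {ι : Type*} (s : Finset ι) (Q : PsDO R) (P : ι → PsDO R) :
    Q * (∑ a ∈ s, P a) = ∑ a ∈ s, Q * P a :=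
  map_sum (AddMonoidHom.mk' (fun P : PsDO R => Q * P) fun _ _ => mul_add _ _ _) P s

theorem neg_mul (P Q : PsDO R) : -P * Q = -(P * Q) :=
  map_neg (AddMonoidHom.mk' (fun P : PsDO R => P * Q) fun _ _ => add_mul _ _ _) P

theorem sub_mul (P Q S : PsDO R) : (P - Q) * S = P * S - Q * S :=
  map_sub (AddMonoidHom.mk' (fun P : PsDO R => P * S) fun _ _ => add_mul _ _ _) P Q

theorem mul_sub (P Q S : PsDO R) : S * (P - Q) = S * P - S * Q :=
  map_sub (AddMonoidHom.mk' (fun P : PsDO R => S * P) fun _ _ => mul_add _ _ _) P Q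

theorem monomial_succ_mul (i : ℕ) (P : PsDO R) :
    monomial ((i + 1 : ℕ) : ℤ) 1 * P = d * (monomial i 1 * P) := by
  rw [← mul_assoc, d, monomial_mul_monomial_one, Nat.cast_add, Nat.cast_one, add_comm]

theorem dInv_mul_d : dInv * d = (1 : PsDO R) := monomial_mul_monomial_one (-1) 1 1

theorem dt_monomial_one (k : ℕ) (i : ℤ) : (monomial i 1 : PsDO R).dt k = 0 := by
  ext1 j
  rw [coeff_dt, coeff_monomial]
  split_ifs <;> simp [TimeFun.dt]

theorem eq_sum_monomial {P : PsDO R} {N : ℕ} (h0 : ∀ i < 0, P.coeff i = 0)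
    (hN : ∀ i, (N : ℤ) ≤ i → P.coeff i = 0) :
    P = ∑ i ∈ Finset.range N, monomial i (P.coeff i) := by
  ext1 j
  rw [coeff_sum]
  simp only [coeff_monomial]
  by_cases hj : 0 ≤ j ∧ j < N
  · lift j to ℕ using hj.1
    rw [Finset.sum_eq_single j] <;> simp
    · intro i _ h1 h2; exact absurd h2.symm h1
    · intro h; exact hN _ (by exact_mod_cast h)
  · rw [Finset.sum_eq_zero]
    · by_cases h : j < 0
      · exact h0 j h
      · exact hN j (by omega)
    · intro i hi
      rw [Finset.mem_range] at hi
      rw [if_neg (by omega)]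

/-- The leading coefficient of `XW` is that of `X`, because `W` starts with 1 in order zero. -/
theorem eq_zero_of_mul_monic {X W : PsDO R} (hW : W.OrdLE 0) (hW0 : W.coeff 0 = 1)
    (h : X * W = 0) : X = 0 := by
  have top : ∀ N, X.OrdLE N → X.coeff N = 0 := by
    intro N hN
    have h1 := congrArg (fun Y => coeff Y N) h
    simp only [coeff_mul, coeff_zero] at h1
    rw [finsum_eq_single _ ((N, 0) : ℤ × ℕ)] at h1
    · simpa [hW0] using h1
    · rintro ⟨i, k⟩ hik
      by_cases h2 : N < i
      · simp [hN i h2]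
      · have : ¬ (i = N ∧ k = 0) := fun h3 => hik (Prod.ext h3.1 h3.2)
        simp [hW (N + k - i) (by omega)]
  obtain ⟨N, hN⟩ := X.exists_bound
  have key : ∀ n : ℕ, X.OrdLE (N - n) := by
    intro n
    induction n with
    | zero => simpa [OrdLE] using hN
    | succ n ih =>
      intro i hi
      rcases eq_or_ne i (N - n) with rfl | h1
      · exact top _ ih
      · exact ih i (by push_cast at hi; omega)
  ext1 i
  exact key (N - i + 1).toNat i (by omega)

theorem coeff_zero_monomial_mul_of_coeff_eq_zero {X : PsDO R} (hX : ∀ i ≤ 0, X.coeff i = 0)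
    (i : ℕ) : (monomial i 1 * X).coeff 0 = 0 := by
  -- The induction needs all orders `j ≤ 0`, since left multiplication by `∂` brings in the
  -- coefficient of order `j - 1`.
  suffices ∀ j ≤ 0, (monomial i 1 * X).coeff j = 0 from this 0 le_rfl
  induction i with
  | zero => exact fun j hj => (congrArg (fun Y => coeff Y j) (one_mul X)).trans (hX j hj)
  | succ i ih =>
    intro j hj
    rw [monomial_succ_mul, coeff_d_mul, ih j hj, ih (j - 1) (by omega)]
    simp [dx]

theorem coeff_zero_monomial_mul_fn (i : ℕ) (h : TimeFun R) :
    (monomial i 1 * fn h).coeff 0 = dx^[i] h := by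
  rw [coeff_monomial_one_mul_fn, if_pos (by omega), sub_zero, Int.toNat_natCast,
    Ring.choose_natCast, Nat.choose_self, Nat.cast_one, one_smul]

theorem d_mul_fn (f : TimeFun R) : d * fn f = fn (dx f) + fn f * d := by
  rw [d_mul]
  congr 1
  ext1 j
  rw [coeff_dt, coeff_fn, coeff_fn]
  split_ifs
  · rfl
  · exact TimeFun.dt_zero 0

theorem fn_mul_fn (f g : TimeFun R) : fn f * fn g = fn (f * g) := by
  ext1 j
  rw [coeff_fn_mul, coeff_fn, coeff_fn]
  split_ifs <;> simp

/-- The induction on `i` rests on `∂ f ∂^{-1} g_x = f_x ∂^{-1} g_x + f g_x`, together with `f g_x +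
f_x g = (fg)_x`. -/
theorem coeff_zero_monomial_mul_fn_dInv_fn (i : ℕ) (f g : TimeFun R) :
    (monomial i 1 * (fn f * dInv * fn (dx g))).coeff 0 = dx^[i] (f * g) - dx^[i] f * g := by
  induction i generalizing f with
  | zero =>
    have h1 : (monomial (R := R) ((0 : ℕ) : ℤ) 1).OrdLE 0 := fun j hj => if_neg (by simpa using hj.ne')
    have h2 : (fn f).OrdLE 0 := fun j hj => if_neg hj.ne'
    have h3 : (dInv : PsDO R).OrdLE (-1) := fun j hj => if_neg hj.ne'
    have h4 : (fn (dx g)).OrdLE 0 := fun j hj => if_neg hj.ne'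
    rw [h1.mul ((h2.mul h3).mul h4) 0 (by norm_num)]
    simp
  | succ i ih =>
    have h1 : d * (fn f * dInv * fn (dx g)) = fn (dx f) * dInv * fn (dx g) + fn (f * dx g) := by
      have h2 : d * dInv = (1 : PsDO R) := monomial_mul_monomial_one 1 (-1) 1
      rw [mul_assoc, ← mul_assoc d, d_mul_fn, add_mul, mul_assoc (fn f), ← mul_assoc d, h2,
        one_mul, fn_mul_fn, mul_assoc (fn (dx f))]
    have h3 : monomial ((i + 1 : ℕ) : ℤ) 1 = (monomial i 1 * d : PsDO R) :=
      (monomial_mul_monomial_one (i : ℤ) 1 1).symm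
    rw [h3, mul_assoc, h1, mul_add, coeff_add, ih, coeff_zero_monomial_mul_fn]
    simp only [Function.iterate_succ_apply]
    have h4 : dx (f * g) = f * dx g + dx f * g := TimeFun.dt_mul 0 f g
    rw [h4, iterate_dx_add]
    ring

end PsDO

/-! ### Functions of two sets of times and the diagonal. -/

namespace BKP

open TimeFun PsDO

section twoTimes

variable {A : Type*} [CommRing A]

instance tendstoCofinite_sumElim_id : Filter.TendstoCofinite (Sum.elim id id : ℕ ⊕ ℕ → ℕ) :=
  (Filter.tendstoCofinite_iff_finite_preimage_singleton _).2 fun b =>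
    (Set.toFinite {Sum.inl b, Sum.inr b}).subset (by rintro (i | i) h <;> simp_all)

/-- The restriction of a function of `t` and `t'` to the diagonal `t' = t`. -/
def diag (F : MvPowerSeries (ℕ ⊕ ℕ) A) : MvPowerSeries ℕ A :=
  MvPowerSeries.rename (Sum.elim id id : ℕ ⊕ ℕ → ℕ) F

theorem diag_mul (F G : MvPowerSeries (ℕ ⊕ ℕ) A) : diag (F * G) = diag F * diag G := map_mul _ _ _

theorem diag_add (F G : MvPowerSeries (ℕ ⊕ ℕ) A) : diag (F + G) = diag F + diag G := map_add _ _ _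

theorem diag_atT (f : MvPowerSeries ℕ A) : diag (atT f) = f := by
  rw [diag, atT, MvPowerSeries.rename_rename]
  exact MvPowerSeries.rename_id_apply f

theorem diag_atT' (f : MvPowerSeries ℕ A) : diag (atT' f) = f := by
  rw [diag, atT', MvPowerSeries.rename_rename]
  exact MvPowerSeries.rename_id_apply f

theorem coeff_sumElim_atT (f : MvPowerSeries ℕ A) (m m' : ℕ →₀ ℕ) :
    MvPowerSeries.coeff (m.sumElim m') (atT f) =
      if m' = 0 then MvPowerSeries.coeff m f else 0 := by
  split_ifs with h
  · rw [h, ← Finsupp.embDomain_inl, atT, MvPowerSeries.coeff_embDomain_rename]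
  · refine MvPowerSeries.coeff_rename_eq_zero _ _ ?_
    rintro ⟨x, hx⟩
    have h1 := Finsupp.embDomain_eq_mapDomain (Function.Embedding.inl : ℕ ↪ ℕ ⊕ ℕ) x
    rw [hx, Finsupp.embDomain_inl] at h1
    refine h (Finsupp.ext fun i => ?_)
    exact (DFunLike.congr_fun h1 (Sum.inr i)).symm

theorem coeff_sumElim_atT' (f : MvPowerSeries ℕ A) (m m' : ℕ →₀ ℕ) :
    MvPowerSeries.coeff (m.sumElim m') (atT' f) =
      if m = 0 then MvPowerSeries.coeff m' f else 0 := by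
  split_ifs with h
  · rw [h, ← Finsupp.embDomain_inr, atT', MvPowerSeries.coeff_embDomain_rename]
  · refine MvPowerSeries.coeff_rename_eq_zero _ _ ?_
    rintro ⟨x, hx⟩
    have h1 := Finsupp.embDomain_eq_mapDomain (Function.Embedding.inr : ℕ ↪ ℕ ⊕ ℕ) x
    rw [hx, Finsupp.embDomain_inr] at h1
    refine h (Finsupp.ext fun i => ?_)
    exact (DFunLike.congr_fun h1 (Sum.inl i)).symm

theorem sumElim_add_single_inl (m m' : ℕ →₀ ℕ) (k : ℕ) :
    m.sumElim m' + Finsupp.single (Sum.inl k) 1 = (m + Finsupp.single k 1).sumElim m' := by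
  rw [← Finsupp.sumElim_single_zero, ← Finsupp.sumElim_add, add_zero]

theorem exists_eq_sumElim (e : ℕ ⊕ ℕ →₀ ℕ) : ∃ m m' : ℕ →₀ ℕ, e = m.sumElim m' :=
  ⟨_, _, (Finsupp.comapDomain_sumElim_comapDomain e).symm⟩

theorem pderiv_atT (k : ℕ) (f : MvPowerSeries ℕ A) :
    MvPowerSeries.pderiv A (Sum.inl k) (atT f) = atT (MvPowerSeries.pderiv A k f) := by
  ext e
  obtain ⟨m, m', rfl⟩ := exists_eq_sumElim e
  rw [MvPowerSeries.coeff_pderiv, sumElim_add_single_inl, coeff_sumElim_atT, coeff_sumElim_atT,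
    MvPowerSeries.coeff_pderiv]
  split_ifs <;> simp

theorem pderiv_atT' (k : ℕ) (f : MvPowerSeries ℕ A) :
    MvPowerSeries.pderiv A (Sum.inl k) (atT' f) = 0 := by
  ext e
  obtain ⟨m, m', rfl⟩ := exists_eq_sumElim e
  rw [MvPowerSeries.coeff_pderiv, sumElim_add_single_inl, coeff_sumElim_atT', if_neg]
  · simp
  · intro h
    simpa using DFunLike.congr_fun h k

theorem mapDomain_sumElim (m m' : ℕ →₀ ℕ) :
    Finsupp.mapDomain (Sum.elim id id : ℕ ⊕ ℕ → ℕ) (m.sumElim m') = m + m' := by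
  rw [Finsupp.sumElim_eq_add, Finsupp.mapDomain_add, ← Finsupp.mapDomain_comp,
    ← Finsupp.mapDomain_comp]
  exact congrArg₂ _ Finsupp.mapDomain_id Finsupp.mapDomain_id

/-- A set of functions of `(t, t')` that is closed under differentiation in `t` and whose members
vanish on the diagonal contains at most `0`. -/
theorem eq_zero_of_diag_eq_zero [IsAddTorsionFree A] (S : Set (MvPowerSeries (ℕ ⊕ ℕ) A))
    (hS : ∀ E ∈ S, ∀ k : ℕ, MvPowerSeries.pderiv A (Sum.inl k) E ∈ S)
    (hd : ∀ E ∈ S, diag E = 0) {E : MvPowerSeries (ℕ ⊕ ℕ) A} (hE : E ∈ S) : E = 0 := by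
  -- Outer induction on the degree in `t'`, inner on the degree in `t`. For degree 0 in `t`, the
  -- diagonal coefficient at `m'` is the wanted one plus terms of smaller `t'`-degree. Otherwise a
  -- `t`-derivative lowers the degree, at the cost of a nonzero integer factor.
  have key : ∀ n : ℕ, ∀ m' : ℕ →₀ ℕ, m'.degree = n → ∀ l : ℕ, ∀ m : ℕ →₀ ℕ, m.degree = l →
      ∀ E ∈ S, MvPowerSeries.coeff (m.sumElim m') E = 0 := by
    intro n
    induction n using Nat.strong_induction_on with
    | _ n ihn =>
    intro m' hm' l
    induction l with
    | zero =>
      intro m hm E hE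
      rw [Finsupp.degree_eq_zero_iff] at hm
      subst hm
      have h := congrArg (MvPowerSeries.coeff m') (hd E hE)
      rw [diag, MvPowerSeries.coeff_rename, map_zero, Finset.sum_eq_single
        ((0 : ℕ →₀ ℕ).sumElim m')] at h
      · exact h
      · intro e he hne
        obtain ⟨p, q, rfl⟩ := exists_eq_sumElim e
        have h1 : p + q = m' := by simpa [mapDomain_sumElim] using he
        have hp : p ≠ 0 := by
          rintro rfl
          exact hne (by rw [← h1, zero_add])
        have h2 : p.degree + q.degree = n := by rw [← map_add, h1, hm']
        have h3 : p.degree ≠ 0 := by rwa [Ne, Finsupp.degree_eq_zero_iff]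
        exact ihn q.degree (by omega) q rfl _ p rfl E hE
      · intro h1
        exact absurd (by simp [mapDomain_sumElim]) h1
    | succ l ihl =>
      intro m hm E hE
      have hm0 : m ≠ 0 := by
        rintro rfl
        simp at hm
      obtain ⟨k, hk⟩ := Finsupp.ne_iff.1 hm0
      obtain ⟨p, rfl⟩ : ∃ p, m = p + Finsupp.single k 1 := by
        refine ⟨m - Finsupp.single k 1, (tsub_add_cancel_of_le ?_).symm⟩
        exact Finsupp.single_le_iff.2 (Nat.one_le_iff_ne_zero.2 hk)
      have h1 := ihl p (by simpa using hm) _ (hS E hE k)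
      rw [MvPowerSeries.coeff_pderiv, sumElim_add_single_inl, Finsupp.sumElim_inl, mul_comm,
        ← Nat.cast_succ, ← nsmul_eq_mul] at h1
      exact (smul_eq_zero_iff_right (Nat.succ_ne_zero _)).1 h1
  ext e
  obtain ⟨m, m', rfl⟩ := exists_eq_sumElim e
  exact key _ m' rfl _ m rfl E hE

theorem pderiv_comm {σ : Type*} (i j : σ) (F : MvPowerSeries σ A) :
    MvPowerSeries.pderiv A i (MvPowerSeries.pderiv A j F) =
      MvPowerSeries.pderiv A j (MvPowerSeries.pderiv A i F) := by
  classical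
  rcases eq_or_ne i j with rfl | h
  · rfl
  ext n
  simp only [MvPowerSeries.coeff_pderiv, Finsupp.add_apply, Finsupp.single_apply, if_neg h,
    if_neg h.symm, add_right_comm n]
  push_cast
  ring

/-- The derivative of a function of `(t, t')` with respect to `t_{2k+1}`. -/
def dT (k : ℕ) (F : MvPowerSeries (ℕ ⊕ ℕ) A) : MvPowerSeries (ℕ ⊕ ℕ) A :=
  MvPowerSeries.pderiv A (Sum.inl k) F

theorem dT_add (k : ℕ) (F G : MvPowerSeries (ℕ ⊕ ℕ) A) : dT k (F + G) = dT k F + dT k G :=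
  map_add _ _ _

theorem dT_sub (k : ℕ) (F G : MvPowerSeries (ℕ ⊕ ℕ) A) : dT k (F - G) = dT k F - dT k G :=
  map_sub _ _ _

theorem dT_mul (k : ℕ) (F G : MvPowerSeries (ℕ ⊕ ℕ) A) :
    dT k (F * G) = F * dT k G + G * dT k F := Derivation.leibniz _ _ _

theorem dT_atT (k : ℕ) (f : TimeFun A) : dT k (atT f) = atT (TimeFun.dt k f) := pderiv_atT k f

theorem dT_atT'_mul (k : ℕ) (f : TimeFun A) (F : MvPowerSeries (ℕ ⊕ ℕ) A) :
    dT k (atT' f * F) = atT' f * dT k F := by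
  rw [dT_mul, dT, dT, pderiv_atT', mul_zero, add_zero]

theorem iterate_dT_atT'_mul (k i : ℕ) (f : TimeFun A) (F : MvPowerSeries (ℕ ⊕ ℕ) A) :
    (dT k)^[i] (atT' f * F) = atT' f * (dT k)^[i] F := by
  induction i with
  | zero => rfl
  | succ i ih => rw [Function.iterate_succ_apply', ih, dT_atT'_mul, Function.iterate_succ_apply']

theorem iterate_dT_atT (i : ℕ) (f : TimeFun A) : (dT 0)^[i] (atT f) = atT (dx^[i] f) := by
  induction i with
  | zero => rfl
  | succ i ih =>
    rw [Function.iterate_succ_apply', ih, dT_atT, Function.iterate_succ_apply']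
    rfl

theorem iterate_dT_sub (k i : ℕ) (F G : MvPowerSeries (ℕ ⊕ ℕ) A) :
    (dT k)^[i] (F - G) = (dT k)^[i] F - (dT k)^[i] G :=
  iterate_map_sub (MvPowerSeries.pderiv A (Sum.inl k)).toLinearMap.toAddMonoidHom i F G

theorem iterate_dT_sum (k i : ℕ) {ι : Type*} (s : Finset ι) (F : ι → MvPowerSeries (ℕ ⊕ ℕ) A) :
    (dT k)^[i] (∑ a ∈ s, F a) = ∑ a ∈ s, (dT k)^[i] (F a) := by
  induction i with
  | zero => rfl
  | succ i ih =>
    simp only [Function.iterate_succ_apply', ih]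
    exact map_sum (MvPowerSeries.pderiv A (Sum.inl k)) _ s

theorem dT_iterate_dT (j k i : ℕ) (F : MvPowerSeries (ℕ ⊕ ℕ) A) :
    dT j ((dT k)^[i] F) = (dT k)^[i] (dT j F) :=
  (Function.Commute.iterate_right (f := dT j) (g := dT k) (fun F => pderiv_comm _ _ F) i) F

end twoTimes

end BKP

/-! ### Uniqueness for the linear system, the bilinear pairing, and dressing. -/

namespace BKP

open TimeFun PsDO

section evolution

variable {R : Type*} [CommRing R]

/-- `F(t, t')` solves the linear system `∂_{2k+1} F = B_{2k+1}(F)` in the times `t`. -/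
def Evolves (L : PsDO R) (F : MvPowerSeries (ℕ ⊕ ℕ) R) : Prop :=
  ∀ k N : ℕ, (∀ i : ℤ, N ≤ i → (B L k).coeff i = 0) →
    dT k F = ∑ i ∈ Finset.range N, atT ((B L k).coeff i) * (dT 0)^[i] F

theorem Evolves.sub {L : PsDO R} {F G : MvPowerSeries (ℕ ⊕ ℕ) R} (hF : Evolves L F)
    (hG : Evolves L G) : Evolves L (F - G) := fun k N h => by
  simp only [dT_sub, hF k N h, hG k N h, iterate_dT_sub, _root_.mul_sub, Finset.sum_sub_distrib]

theorem Evolves.sum {L : PsDO R} {ι : Type*} {s : Finset ι} {F : ι → MvPowerSeries (ℕ ⊕ ℕ) R}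
    (hF : ∀ a ∈ s, Evolves L (F a)) : Evolves L (∑ a ∈ s, F a) := fun k N h => by
  have h1 := iterate_dT_sum k 1 s F
  simp only [Function.iterate_one] at h1
  simp only [h1, iterate_dT_sum, Finset.mul_sum]
  rw [Finset.sum_comm]
  exact Finset.sum_congr rfl fun a ha => hF a ha k N h

theorem Evolves.atT'_mul {L : PsDO R} {F : MvPowerSeries (ℕ ⊕ ℕ) R} (hF : Evolves L F)
    (f : TimeFun R) : Evolves L (atT' f * F) := fun k N h => by
  rw [dT_atT'_mul, hF k N h, Finset.mul_sum]
  refine Finset.sum_congr rfl fun i _ => ?_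
  rw [iterate_dT_atT'_mul]
  ring

theorem IsEigenfunction.evolves {L : PsDO R} {Φ : TimeFun R} (h : IsEigenfunction L Φ) :
    Evolves L (atT Φ) := fun k N hN => by
  have h1 : (B L k).applyFn Φ = ∑ i ∈ Finset.range N, (B L k).coeff i * dx^[i] Φ := by
    refine finsum_eq_sum_of_support_subset _ fun i hi => ?_
    rw [Finset.coe_range, Set.mem_Iio]
    by_contra h2
    exact hi (by simp [hN i (by omega)])
  have h2 : atT (∑ i ∈ Finset.range N, (B L k).coeff i * dx^[i] Φ) =
      ∑ i ∈ Finset.range N, atT ((B L k).coeff i * dx^[i] Φ) :=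
    map_sum (MvPowerSeries.rename (R := R) (Function.Embedding.inl : ℕ ↪ ℕ ⊕ ℕ)) _ _
  rw [dT_atT, h k, h1, h2]
  refine Finset.sum_congr rfl fun i _ => ?_
  rw [iterate_dT_atT]
  exact map_mul (MvPowerSeries.rename (R := R) (Function.Embedding.inl : ℕ ↪ ℕ ⊕ ℕ)) _ _

/-- A solution of the linear system is determined by the diagonal values of its
`x`-derivatives. -/
theorem Evolves.eq_zero [IsAddTorsionFree R] {L : PsDO R} {F : MvPowerSeries (ℕ ⊕ ℕ) R}
    (hF : Evolves L F) (hd : ∀ i : ℕ, diag ((dT 0)^[i] F) = 0) : F = 0 := by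
  -- The additive span of all `f(t) ∂_x^i F`. The linear system turns every `t`-derivative of `F`
  -- into x-derivatives, so this span is stable under all of them, and it vanishes on the diagonal
  -- by `hd`.
  let S : AddSubmonoid (MvPowerSeries (ℕ ⊕ ℕ) R) := AddSubmonoid.closure
    (Set.range fun p : TimeFun R × ℕ => atT p.1 * (dT 0)^[p.2] F)
  have hgen : ∀ (f : TimeFun R) (i : ℕ), atT f * (dT 0)^[i] F ∈ S := fun f i =>
    AddSubmonoid.subset_closure ⟨(f, i), rfl⟩
  have hgen1 : ∀ i : ℕ, (dT 0)^[i] F ∈ S := fun i => by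
    have := hgen 1 i
    rwa [atT, map_one, _root_.one_mul] at this
  have mul_mem : ∀ f : TimeFun R, ∀ E ∈ S, atT f * E ∈ S := fun f E hE => by
    induction hE using AddSubmonoid.closure_induction with
    | mem x hx =>
      obtain ⟨p, rfl⟩ := hx
      have h1 := hgen (f * p.1) p.2
      rw [atT, map_mul] at h1
      simpa only [_root_.mul_assoc, atT] using h1
    | zero => simp
    | add x y _ _ hx hy => rw [_root_.mul_add]; exact S.add_mem hx hy
  have dT_mem : ∀ k : ℕ, (∀ i : ℕ, dT k ((dT 0)^[i] F) ∈ S) → ∀ E ∈ S, dT k E ∈ S := by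
    intro k hk E hE
    induction hE using AddSubmonoid.closure_induction with
    | mem x hx =>
      obtain ⟨p, rfl⟩ := hx
      simp only [dT_mul, dT_atT]
      refine S.add_mem (mul_mem _ _ (hk _)) ?_
      rw [mul_comm]
      exact hgen _ _
    | zero => simp [dT]
    | add x y _ _ hx hy => rw [dT_add]; exact S.add_mem hx hy
  have dT0_mem : ∀ E ∈ S, dT 0 E ∈ S := dT_mem 0 fun i => by
    rw [← Function.iterate_succ_apply' (dT 0)]
    exact hgen1 _
  have iterate_mem : ∀ i : ℕ, ∀ E ∈ S, (dT 0)^[i] E ∈ S := fun i E hE => by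
    induction i with
    | zero => exact hE
    | succ i ih => rw [Function.iterate_succ_apply']; exact dT0_mem _ ih
  refine eq_zero_of_diag_eq_zero (S : Set (MvPowerSeries (ℕ ⊕ ℕ) R))
    (fun E hE k => dT_mem k (fun i => ?_) E hE) (fun E hE => ?_) (hgen1 0)
  · obtain ⟨N, hN⟩ := (B L k).exists_bound
    rw [dT_iterate_dT, hF k (N + 1).toNat fun i hi => hN i (by omega)]
    exact iterate_mem _ _ (S.sum_mem fun j _ => hgen _ _)
  · induction hE using AddSubmonoid.closure_induction with
    | mem x hx =>
      obtain ⟨p, rfl⟩ := hx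
      simp only [diag_mul, hd, mul_zero]
    | zero => exact map_zero _
    | add x y _ _ hx hy => rw [diag_add, hx, hy, add_zero]

end evolution

section bilinear

variable {R : Type*} [CommRing R] [Algebra ℚ R]

/-- The generating function `∫ dλ P(e^{ξ(t,λ)}) ψ_BA(t',-λ)`. -/
def pairing (W P : PsDO R) : MvPowerSeries (ℕ ⊕ ℕ) R :=
  residue (atT (symbol P * expXi R) * atT' (negLam (waveFunction W)))

theorem pairing_add (W P Q : PsDO R) : pairing W (P + Q) = pairing W P + pairing W Q := by
  simp only [pairing, symbol_add, _root_.add_mul, atT, map_add, residue_add]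

theorem pairing_sum (W : PsDO R) {ι : Type*} (s : Finset ι) (P : ι → PsDO R) :
    pairing W (∑ a ∈ s, P a) = ∑ a ∈ s, pairing W (P a) :=
  map_sum (AddMonoidHom.mk' (pairing W) (pairing_add W)) P s

theorem pairing_fn_mul (W P : PsDO R) (f : TimeFun R) :
    pairing W (fn f * P) = atT f * pairing W P := by
  rw [pairing, symbol_fn_mul, atT, _root_.mul_assoc, map_mul, MvPowerSeries.rename_map, _root_.mul_assoc,
    residue_map_C_mul]
  rfl

/-- Only `P(e^ξ)` depends on `t`, and differentiating the exponential brings down `λ^{2k+1}`, which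
is right multiplication by `∂^{2k+1}`. -/
theorem dT_pairing (k : ℕ) (W P : PsDO R) :
    dT k (pairing W P) = pairing W (P.dt k + P * monomial (2 * k + 1) 1) := by
  rw [pairing, dT, pderiv_residue, Derivation.leibniz, pderiv_atT, pderiv_atT',
    Derivation.leibniz, pderiv_symbol, pderiv_expXi, smul_zero, zero_add, pairing, symbol_add,
    symbol_mul_monomial_one, smul_eq_mul, smul_eq_mul, smul_eq_mul, mul_comm (atT' _)]
  congr 3
  ring

theorem pairing_monomial_one_mul (W P : PsDO R) (i : ℕ) :
    pairing W (monomial i 1 * P) = (dT 0)^[i] (pairing W P) := by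
  induction i with
  | zero => exact congrArg _ (PsDO.one_mul P)
  | succ i ih =>
    rw [monomial_succ_mul, d_mul, Function.iterate_succ_apply', ← ih, dT_pairing]
    rfl

theorem diag_pairing (W P : PsDO R) : diag (pairing W P) = (P * W.adjoint).coeff (-1) := by
  rw [pairing, diag, rename_residue, ← diag, diag_mul, diag_atT, diag_atT', waveFunction,
    negLam_eq_map, map_mul, mul_mul_mul_comm, ← negLam_eq_map, ← negLam_eq_map,
    expXi_mul_negLam_expXi, _root_.mul_one, residue_symbol_mul_negLam_symbol]

theorem evolves_pairing {L W P : PsDO R}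
    (h : ∀ k, P.dt k + P * monomial (2 * k + 1) 1 = B L k * P) : Evolves L (pairing W P) :=
  fun k N hN => by
    have h0 : ∀ i < 0, (B L k).coeff i = 0 := fun i hi => if_neg (by omega)
    rw [dT_pairing, h k]
    conv_lhs => rw [eq_sum_monomial h0 hN]
    rw [PsDO.sum_mul, pairing_sum]
    refine Finset.sum_congr rfl fun i _ => ?_
    rw [← fn_mul_monomial_one, fn_mul_mul, pairing_fn_mul, pairing_monomial_one_mul]

end bilinear

section dressing

variable {R : Type*} [CommRing R] {L W : PsDO R}

theorem IsDressing.pow_mul (hW : IsDressing L W) (k : ℕ) : L ^ k * W = W * monomial k 1 := by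
  induction k with
  | zero => exact (PsDO.one_mul W).trans (PsDO.mul_one W).symm
  | succ k ih =>
    rw [PsDO.pow_succ, PsDO.mul_assoc, hW.dressing, ← PsDO.mul_assoc, ih, PsDO.mul_assoc, d,
      monomial_mul_monomial_one, Nat.cast_succ]

/-- The constraint makes `∂^{-1} W^* ∂` a left inverse of `W`; cancelling `W` on the right makes it
a right inverse. -/
theorem IsDressing.mul_inverse (hW : IsDressing L W) : W * (dInv * (W.adjoint * d)) = 1 := by
  refine (sub_eq_zero.1 (eq_zero_of_mul_monic hW.coeff_of_pos hW.coeff_zero ?_)).symm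
  rw [PsDO.sub_mul, PsDO.one_mul, PsDO.mul_assoc, PsDO.mul_assoc, hW.constraint, dInv_mul_d,
    PsDO.mul_one, sub_self]

theorem IsDressing.pow_eq (hW : IsDressing L W) (n : ℕ) :
    L ^ (2 * n + 1) = W * monomial (2 * n) 1 * W.adjoint * d := by
  rw [← PsDO.mul_one (L ^ (2 * n + 1)), ← hW.mul_inverse, ← PsDO.mul_assoc, hW.pow_mul,
    PsDO.mul_assoc W, ← PsDO.mul_assoc (monomial _ 1), dInv, monomial_mul_monomial_one,
    PsDO.mul_assoc, PsDO.mul_assoc]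
  congr 3
  push_cast
  ring

/-- Right multiplication by `∂^{2k+1}` becomes left multiplication by `L^{2k+1}`, whose integral
part is cancelled by Sato's equation. -/
theorem IsDressing.dt_add (hW : IsDressing L W) (n k : ℕ) :
    (W * monomial (2 * n) 1).dt k + W * monomial (2 * n) 1 * monomial (2 * k + 1) 1 =
      B L k * (W * monomial (2 * n) 1) := by
  have h1 : W * monomial (2 * n) 1 * monomial (2 * k + 1) 1 =
      L ^ (2 * k + 1) * (W * monomial (2 * n) 1) := by
    rw [← PsDO.mul_assoc, hW.pow_mul, PsDO.mul_assoc, PsDO.mul_assoc, monomial_mul_monomial_one,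
      monomial_mul_monomial_one, add_comm]
    push_cast
    rfl
  have h2 : W * (0 : PsDO R) = 0 := by simpa using PsDO.mul_add W 0 0
  have h3 := posPart_add_negPart (L ^ (2 * k + 1))
  rw [h1, PsDO.dt_mul, dt_monomial_one, h2, add_zero, hW.sato, PsDO.neg_mul, PsDO.mul_assoc]
  nth_rw 2 [← h3]
  rw [PsDO.add_mul, B]
  abel

/-- The differential part of `L^{2n+1}` has no term of order zero. -/
theorem IsDressing.coeff_zero_pow [IsAddTorsionFree R] (hW : IsDressing L W) (n : ℕ) :
    (L ^ (2 * n + 1)).coeff 0 = 0 := by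
  rw [hW.pow_eq, coeff_mul_d, zero_sub, ← residue_symbol_mul_negLam_symbol,
    symbol_mul_monomial_one]
  set F := MvPowerSeries.C (lam R (2 * n)) * symbol W * negLam (symbol W) with hF
  -- `λ^{2n} W(λ) W(-λ)` is even in `λ`, whereas the residue changes sign under `λ ↦ -λ`.
  have h1 : negLam F = F := by
    have h2 : negLamHom R (lam R (2 * n)) = lam R (2 * n) := by
      rw [negLamHom_lam, Int.negOnePow_two_mul]
      simp
    rw [hF, negLam_eq_map, map_mul, map_mul, MvPowerSeries.map_C, h2, ← negLam_eq_map,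
      ← negLam_eq_map, negLam_negLam]
    ring
  have h3 := residue_negLam F
  rw [h1] at h3
  have h4 : (2 : ℕ) • residue F = 0 := by
    rw [two_nsmul]
    nth_rw 1 [h3]
    exact neg_add_cancel _
  ext m
  have h5 := congrArg (MvPowerSeries.coeff m) h4
  rw [map_nsmul, map_zero] at h5
  exact (smul_eq_zero_iff_right two_ne_zero).1 h5

theorem coeff_zero_monomial_mul_ghostOperator {ι : Type*} [Fintype ι] (Φ₁ Φ₂ : ι → TimeFun R)
    (i : ℕ) : (monomial i 1 * ghostOperator Φ₁ Φ₂).coeff 0 =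
      ∑ a, (Φ₂ a * dx^[i] (Φ₁ a) - Φ₁ a * dx^[i] (Φ₂ a)) := by
  rw [ghostOperator, PsDO.mul_sum, PsDO.coeff_sum]
  refine Finset.sum_congr rfl fun a _ => ?_
  rw [PsDO.mul_sub, PsDO.coeff_sub, coeff_zero_monomial_mul_fn_dInv_fn,
    coeff_zero_monomial_mul_fn_dInv_fn, mul_comm (Φ₂ a) (Φ₁ a)]
  ring

end dressing

end BKP

end

theorem mainTheorem9 {R : Type*} [CommRing R] [Algebra ℚ R] {ι : Type*} [Fintype ι]
    (L W : PsDO R) (hL : BKP.IsSolution L) (hW : BKP.IsDressing L W)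
    (Φ₁ Φ₂ : ι → TimeFun R)
    (hΦ₁ : ∀ a, BKP.IsEigenfunction L (Φ₁ a)) (hΦ₂ : ∀ a, BKP.IsEigenfunction L (Φ₂ a))
    (n : ℕ) (hc : (L ^ (2 * n + 1)).negPart = BKP.ghostOperator Φ₁ Φ₂) :
    BKP.residue (MvPowerSeries.C (BKP.lam R (2 * n)) *
        BKP.atT (BKP.waveFunction W) * BKP.atT' (BKP.negLam (BKP.waveFunction W))) =
      ∑ a, (BKP.atT' (Φ₂ a) * BKP.atT (Φ₁ a) - BKP.atT' (Φ₁ a) * BKP.atT (Φ₂ a)) := by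
  have : IsAddTorsionFree R := BKP.isAddTorsionFree_of_algebra_rat R
  have hlhs : BKP.residue (MvPowerSeries.C (BKP.lam R (2 * n)) *
      BKP.atT (BKP.waveFunction W) * BKP.atT' (BKP.negLam (BKP.waveFunction W))) =
      BKP.pairing W (W * PsDO.monomial (2 * n) 1) := by
    rw [BKP.pairing, BKP.symbol_mul_monomial_one, mul_assoc (MvPowerSeries.C _) (BKP.symbol W),
      ← BKP.waveFunction, BKP.atT, BKP.atT, map_mul, MvPowerSeries.rename_C]
  rw [hlhs]
  refine sub_eq_zero.1 (BKP.Evolves.eq_zero (L := L) ?_ fun i => ?_)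
  · exact (BKP.evolves_pairing (hW.dt_add n)).sub (BKP.Evolves.sum fun a _ =>
      ((hΦ₁ a).evolves.atT'_mul _).sub ((hΦ₂ a).evolves.atT'_mul _))
  · have hB : (PsDO.monomial i 1 * (L ^ (2 * n + 1)).posPart).coeff 0 = 0 := by
      refine PsDO.coeff_zero_monomial_mul_of_coeff_eq_zero (fun j hj => ?_) i
      rw [PsDO.coeff_posPart]
      split_ifs with h
      · rw [le_antisymm hj h, hW.coeff_zero_pow]
      · rfl
    have h1 : BKP.diag ((BKP.dT 0)^[i] (BKP.pairing W (W * PsDO.monomial (2 * n) 1))) =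
        ∑ a, (Φ₂ a * TimeFun.dx^[i] (Φ₁ a) - Φ₁ a * TimeFun.dx^[i] (Φ₂ a)) := by
      -- Right multiplication by `∂` turns the coefficient of `∂^{-1}` into that of `∂^0` and
      -- completes the factor `L^{2n+1}`.
      have h2 := PsDO.coeff_mul_d (PsDO.monomial i 1 * (W * PsDO.monomial (2 * n) 1) * W.adjoint) 0
      rw [PsDO.mul_assoc, PsDO.mul_assoc, ← PsDO.mul_assoc (W * _), ← hW.pow_eq,
        ← PsDO.posPart_add_negPart (L ^ _), PsDO.mul_add, PsDO.coeff_add, hB, hc, zero_add,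
        BKP.coeff_zero_monomial_mul_ghostOperator, zero_sub] at h2
      rw [← BKP.pairing_monomial_one_mul, BKP.diag_pairing, ← h2]
    have h3 : BKP.diag (∑ a, (BKP.atT' (Φ₂ a) * BKP.atT (TimeFun.dx^[i] (Φ₁ a)) -
        BKP.atT' (Φ₁ a) * BKP.atT (TimeFun.dx^[i] (Φ₂ a)))) =
        ∑ a, (Φ₂ a * TimeFun.dx^[i] (Φ₁ a) - Φ₁ a * TimeFun.dx^[i] (Φ₂ a)) := by
      rw [BKP.diag, map_sum]
      refine Finset.sum_congr rfl fun a _ => ?_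
      rw [map_sub, ← BKP.diag, ← BKP.diag, BKP.diag_mul, BKP.diag_mul, BKP.diag_atT,
        BKP.diag_atT, BKP.diag_atT', BKP.diag_atT']
    rw [BKP.iterate_dT_sub, BKP.iterate_dT_sum]
    simp only [BKP.iterate_dT_sub, BKP.iterate_dT_atT'_mul, BKP.iterate_dT_atT]
    rw [BKP.diag, map_sub, ← BKP.diag, ← BKP.diag, h1, h3, sub_self]
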